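/- Theorem. A family $\mathcal C$ of subsets of a uniform space $X$ is a uniform cover if there is an entourage $V$ such that every set $V[x]=\{y:(x,y)\in V\}$, $x\in X$, is contained in a member of $\mathcal C$. For $A\subseteq X$ put $St^0(A,\mathcal C)=A$ and $St^{m+1}(A,\mathcal C)=\bigcup\{C\in\mathcal C: C\cap St^m(A,\mathcal C)\neq\emptyset\}$. A (proper) filter $\mathcal F$ on $X$ is Bourbaki-Cauchy if for every uniform cover $\mathcal U$ there are $m\in\mathbb N$, $U\in\mathcal U$ and $F\in\mathcal F$ with $F\subseteq St^m(U,\mathcal U)$, and $X$ is Bourbaki-complete if every Bourbaki-Cauchy filter has a cluster point. A uniform partition of $X$ is a partition of $X$ into non-empty sets that is a uniform cover, and $\wp(X,\mu)=\sup\{|\mathcal P|:\mathcal P\text{ a uniform partition of }(X,\mu)\}$. Let $(X,\mu)$ be a Hausdorff Bourbaki-complete uniform space. Then there exist a set $I$, cardinals $\kappa^i_n$ ($i\in I$, $n\in\{1,2,\dots\}$), each endowed with the uniformly discrete metric (distinct points are at distance $1$), a cardinal $\alpha\ge\omega_0$, and a map $$\varphi:(X,\mu)\to\Big(\Big(\prod_{i\in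 I,\,n\ge 1}\kappa^i_n\Big)\times\mathbb R^{\alpha},\ \pi\Big),$$ where $\pi$ is the product uniformity, such that $\varphi$ is a topological embedding (a homeomorphism onto its image), $\varphi$ is uniformly continuous, and $\varphi(X)$ is closed in $\big(\prod_{i\in I,\,n\ge 1}\kappa^i_n\big)\times\mathbb R^{\alpha}$. Moreover, $$\wp(X,\mu)\ \le\ \sup\Big\{\prod_{j=1}^{n}\kappa^i_j : n\ge 1,\ i\in I\Big\}.$$ -/

import Mathlib

open scoped Uniformity Cardinal

universe u

noncomputable section

namespace Bourbaki

/-- The star `St(A, C)` of a set `A` with respect to a family `C` of sets. -/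
def star {X : Type u} (C : Set (Set X)) (A : Set X) : Set X :=
  ⋃₀ {U | U ∈ C ∧ (U ∩ A).Nonempty}

/-- The iterated star: `St^0(A, C) = A` and `St^(m+1)(A, C) = St(St^m(A, C), C)`. -/
def iterStar {X : Type u} (C : Set (Set X)) (A : Set X) : ℕ → Set X
  | 0 => A
  | m + 1 => star C (iterStar C A m)

/-- A family `C` of subsets of `X` is a uniform cover if, for some entourage `V`, each of the sets
`V[x] = {y | (x, y) ∈ V}` is contained in a member of `C` (that is, `C` is refined by a cover
`{V[x] : x ∈ X}`; such a family covers `X` because `x ∈ V[x]`). -/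
def IsUniformCover {X : Type u} [UniformSpace X] (C : Set (Set X)) : Prop :=
  ∃ V ∈ 𝓤 X, ∀ x : X, ∃ U ∈ C, UniformSpace.ball x V ⊆ U

/-- For every uniform cover `C`, the filter contains a set inside some `St^m(U, C)`, `U ∈ C`. -/
def IsBourbakiCauchy {X : Type u} [UniformSpace X] (F : Filter X) : Prop :=
  ∀ C : Set (Set X), IsUniformCover C → ∃ m : ℕ, ∃ U ∈ C, ∃ A ∈ F, A ⊆ iterStar C U m

/-- Every (proper) Bourbaki-Cauchy filter has a cluster point. -/
def IsBourbakiComplete (X : Type u) [UniformSpace X] : Prop :=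
  ∀ F : Filter X, F.NeBot → IsBourbakiCauchy F → ∃ x : X, ClusterPt x F

/-- A uniform partition: a partition of `X` into non-empty sets that is a uniform cover. -/
def IsUniformPartition {X : Type u} [UniformSpace X] (P : Set (Set X)) : Prop :=
  Setoid.IsPartition P ∧ IsUniformCover P

/-- The supremum of the cardinalities of the uniform partitions of `X`. -/
def partitionCardinal (X : Type u) [UniformSpace X] : Cardinal.{u} :=
  ⨆ P : {P : Set (Set X) // IsUniformPartition P}, #(P : Set (Set X))

/-- A set of cardinality `κ`; it carries the uniformly discrete metric below. -/
def DiscreteCardinal (κ : Cardinal.{u}) : Type u := κ.out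

open Classical in
/-- The uniformly discrete metric: distinct points are at distance `1`. -/
instance (κ : Cardinal.{u}) : MetricSpace (DiscreteCardinal κ) where
  dist d e := if d = e then 0 else 1
  dist_self d := if_pos rfl
  dist_comm d e := by simp only [eq_comm]
  dist_triangle a b c := by
    by_cases h₁ : a = b
    · subst h₁; simp
    · simp only [if_neg h₁]
      split_ifs <;> norm_num
  eq_of_dist_eq_zero {d e} h := by
    by_contra hne
    exact one_ne_zero ((if_neg hne).symm.trans h)

/-- The uniformity of the uniformly discrete metric is the discrete uniformity. -/
instance (κ : Cardinal.{u}) : DiscreteUniformity (DiscreteCardinal κ) := by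
  rw [discreteUniformity_iff_setRelId_mem_uniformity]
  refine Metric.mem_uniformity_dist.2 ⟨1, one_pos, fun {a b} h => ?_⟩
  by_contra hne
  have hd : dist a b = 1 := if_neg hne
  exact absurd h (by rw [hd]; exact lt_irrefl _)

end Bourbaki

end

open Filter Topology Set

noncomputable section

namespace Bourbaki

/-! The coordinates are all uniform partitions, as discrete spaces, and all uniformly continuous
real functions. The real coordinates alone induce the topology: every entourage belongs to a coarser
pseudometric uniformity, whose distance functions are uniformly continuous. The Hausdorff property
then gives injectivity.

For closedness, a point of the closure of the image yields a filter on X along which all coordinates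
converge. Such a filter is Bourbaki-Cauchy, and the image of a cluster point must be the given
point. The crux is `exists_isUniformPartition_of_isUniformCover`: the ε-chain classes of a suitable
pseudometric form a uniform partition, and on each class a uniformly continuous function controls
the number of steps from a base point. Eventual constancy of the class together with eventual
boundedness of that function traps the filter in one iterated star. -/

/-! ### Pseudometrics below a uniformity -/

/-- Every entourage belongs to the uniformity of some coarser pseudometric. -/
theorem exists_coarser_pseudoMetricSpace {X : Type u} [u : UniformSpace X] {V : Set (X × X)}
    (hV : V ∈ 𝓤 X) :
    ∃ I : PseudoMetricSpace X, u ≤ I.toUniformSpace ∧ V ∈ 𝓤[I.toUniformSpace] := by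
  have step : ∀ W : {W : SetRel X X // W ∈ 𝓤 X ∧ W.IsSymm},
      ∃ W' : {W : SetRel X X // W ∈ 𝓤 X ∧ W.IsSymm}, SetRel.comp W'.1 W'.1 ⊆ W.1 := by
    rintro ⟨W, hW, -⟩
    obtain ⟨W', hW', hsymm, hcomp⟩ := comp_symm_mem_uniformity_sets hW
    exact ⟨⟨W', hW', hsymm⟩, hcomp⟩
  choose next hnext using step
  obtain ⟨W₀, hW₀, hsymm₀, hcomp₀⟩ := comp_symm_mem_uniformity_sets hV
  have hsub : W₀ ⊆ V := fun p hp => hcomp₀ ⟨p.2, hp, refl_mem_uniformity hW₀⟩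
  let W : ℕ → {W : SetRel X X // W ∈ 𝓤 X ∧ W.IsSymm} :=
    fun n => Nat.rec ⟨W₀, hW₀, hsymm₀⟩ (fun _ => next) n
  have hW : ∀ n, SetRel.comp (W (n + 1)).1 (W (n + 1)).1 ⊆ (W n).1 := fun n => hnext (W n)
  have hanti : Antitone fun n => (W n).1 := antitone_nat_of_succ_le fun n p hp =>
    hW n ⟨p.2, hp, refl_mem_uniformity (W (n + 1)).2.1⟩
  have hbasis : (⨅ n, 𝓟 (W n).1).HasBasis (fun _ : ℕ => True) fun n => (W n).1 :=
    hasBasis_iInf_principal hanti.directed_ge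
  let core : UniformSpace.Core X :=
    { uniformity := ⨅ n, 𝓟 (W n).1
      refl := le_iInf fun n => principal_mono.2 fun p hp => by
        obtain ⟨x, y⟩ := p
        obtain rfl : x = y := hp
        exact refl_mem_uniformity (W n).2.1
      symm := hbasis.tendsto_right_iff.2 fun n _ =>
        hbasis.mem_iff.2 ⟨n, trivial, fun p hp => (W n).2.2.symm _ _ hp⟩
      comp := fun s hs => by
        obtain ⟨n, -, hn⟩ := hbasis.mem_iff.1 hs
        exact mem_of_superset
          (mem_lift' (hbasis.mem_of_mem (i := n + 1) trivial)) ((hW n).trans hn) }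
  let v : UniformSpace X := UniformSpace.ofCore core
  have hv : 𝓤[v] = ⨅ n, 𝓟 (W n).1 := rfl
  -- The countable base makes `v` pseudometrizable; it is coarser than the given uniformity because
  -- every `W n` is an entourage there.
  have : IsCountablyGenerated 𝓤[v] := by rw [hv]; infer_instance
  obtain ⟨I, hI⟩ := @UniformSpace.metrizable_uniformity X v this
  refine ⟨I, ?_, ?_⟩
  · rw [hI]
    exact le_iInf fun n => le_principal_iff.2 (W n).2.1
  · rw [hI, hv]
    exact hbasis.mem_iff.2 ⟨0, trivial, hsub⟩

theorem uniformContinuous_of_coarser {X : Type u} {u v : UniformSpace X} (h : u ≤ v) {f : X → ℝ}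
    (hf : UniformContinuous[v, _] f) : UniformContinuous[u, _] f :=
  have h' : 𝓤[u] ≤ 𝓤[v] := h
  Tendsto.mono_left hf h'

theorem uniformContinuous_dist_left {X : Type u} [PseudoMetricSpace X] (x : X) :
    UniformContinuous fun y => dist x y :=
  uniformContinuous_const.dist uniformContinuous_id

/-- Uniformly continuous real functions separate points from complements of neighbourhoods. -/
theorem exists_uniformContinuous_ball {X : Type u} [u : UniformSpace X] {V : Set (X × X)}
    (hV : V ∈ 𝓤 X) (x : X) :
    ∃ f : X → ℝ, UniformContinuous f ∧ ∃ ε > 0, ∀ y, |f y - f x| < ε → (x, y) ∈ V := by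
  obtain ⟨I, hle, hVI⟩ := exists_coarser_pseudoMetricSpace hV
  obtain ⟨ε, hε, h⟩ := Metric.mem_uniformity_dist.1 hVI
  refine ⟨fun y => dist x y, uniformContinuous_of_coarser (u := u) hle
    (uniformContinuous_dist_left x), ε, hε, fun y hy => h ?_⟩
  simpa using hy

/-! ### Chains of small steps and their length -/

section Chain

variable {X : Type u} [PseudoMetricSpace X] (ε : ℝ) (a : X)

/-- The points that can be reached from `a` by a chain of at most `k` steps shorter than `ε`. -/
def chainBall : ℕ → Set X
  | 0 => {a}
  | k + 1 => Metric.thickening ε (chainBall k)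

variable {ε}

theorem mem_chainBall_succ_of_dist_lt {k : ℕ} {x y : X} (hx : x ∈ chainBall ε a k)
    (h : dist x y < ε) : y ∈ chainBall ε a (k + 1) :=
  Metric.mem_thickening_iff.2 ⟨x, hx, by rwa [dist_comm]⟩

theorem monotone_chainBall (hε : 0 < ε) : Monotone (chainBall ε a) :=
  monotone_nat_of_le_succ fun _ => Metric.self_subset_thickening hε _

theorem nonempty_chainBall (hε : 0 < ε) (k : ℕ) : (chainBall ε a k).Nonempty :=
  ⟨a, monotone_chainBall a hε (Nat.zero_le k) (mem_singleton a)⟩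

variable (ε) in
/-- The truncated distance to the `k`-th chain ball, normalised to take values in `[0, 1]`. -/
def chainStep (k : ℕ) (x : X) : ℝ := min 1 (Metric.infDist x (chainBall ε a k) / ε)

theorem chainStep_nonneg (hε : 0 < ε) (k : ℕ) (x : X) : 0 ≤ chainStep ε a k x :=
  le_min zero_le_one (div_nonneg Metric.infDist_nonneg hε.le)

theorem chainStep_eq_zero {k : ℕ} {x : X} (hx : x ∈ chainBall ε a k) :
    chainStep ε a k x = 0 := by
  simp [chainStep, Metric.infDist_zero_of_mem hx]

theorem chainStep_eq_one (hε : 0 < ε) {k : ℕ} {x : X} (hx : x ∉ chainBall ε a (k + 1)) :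
    chainStep ε a k x = 1 := by
  refine min_eq_left ((one_le_div hε).2 (not_lt.1 fun h => hx ?_))
  obtain ⟨y, hy, hxy⟩ := (Metric.infDist_lt_iff (nonempty_chainBall a hε k)).1 h
  exact Metric.mem_thickening_iff.2 ⟨y, hy, hxy⟩

theorem abs_chainStep_sub_le (hε : 0 < ε) (k : ℕ) (x y : X) :
    |chainStep ε a k x - chainStep ε a k y| ≤ dist x y / ε := by
  refine (abs_min_sub_min_le_max _ _ _ _).trans ?_
  have h := (Metric.lipschitz_infDist_pt (chainBall ε a k)).dist_le_mul x y
  rw [Real.dist_eq, NNReal.coe_one, one_mul] at h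
  rw [sub_self, abs_zero, ← sub_div, abs_div, abs_of_pos hε]
  exact max_le (by positivity) (by gcongr)

open Classical in
variable (ε) in
/-- A uniformly continuous function which is comparable with the length of the shortest chain
from `a`, and vanishes at the points that no chain from `a` reaches. -/
def chainLength (x : X) : ℝ :=
  if h : ∃ n, x ∈ chainBall ε a n then ∑ k ∈ Finset.range (Nat.find h), chainStep ε a k x else 0

theorem chainLength_eq_sum (hε : 0 < ε) {n : ℕ} {x : X} (hx : x ∈ chainBall ε a n) :
    chainLength ε a x = ∑ k ∈ Finset.range n, chainStep ε a k x := by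
  classical
  have h : ∃ n, x ∈ chainBall ε a n := ⟨n, hx⟩
  rw [chainLength, dif_pos h]
  refine Finset.sum_subset (Finset.range_mono (Nat.find_min' h hx)) fun k _ hk => ?_
  exact chainStep_eq_zero a
    (monotone_chainBall a hε (not_lt.1 (mt Finset.mem_range.2 hk)) (Nat.find_spec h))

/-- Outside the `M`-th chain ball the first `M` terms of the sum all equal 1, and the others are
nonnegative. -/
theorem mem_chainBall_of_chainLength_lt (hε : 0 < ε) {M : ℕ} {x : X}
    (hx : ∃ n, x ∈ chainBall ε a n) (hlt : chainLength ε a x < M) : x ∈ chainBall ε a M := by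
  by_contra hM
  obtain ⟨n, hn⟩ := hx
  have hMn : M ≤ n := le_of_not_ge fun h => hM (monotone_chainBall a hε h hn)
  refine hlt.not_ge ?_
  rw [chainLength_eq_sum a hε hn]
  calc (M : ℝ) = ∑ k ∈ Finset.range M, chainStep ε a k x := by
        rw [Finset.sum_congr rfl fun k hk => chainStep_eq_one a hε fun h =>
          hM (monotone_chainBall a hε (Finset.mem_range.1 hk) h)]
        simp
    _ ≤ _ := Finset.sum_le_sum_of_subset_of_nonneg (Finset.range_mono hMn)
        fun k _ _ => chainStep_nonneg a hε k x

/-- Here `n` is the first stage that reaches `x` or `y`, and the other point is reached by stage `n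
+ 1`. Terms with `k + 1 < n` are 1 at both points and terms beyond `n` vanish at both. At most the
terms `n - 1` and `n` differ, each by at most `dist x y / ε`; hence the factor 2. -/
theorem abs_chainLength_sub_le_of_mem (hε : 0 < ε) {n : ℕ} {x y : X} (hxy : dist x y < ε)
    (hx : x ∈ chainBall ε a n) (hx' : ∀ m < n, x ∉ chainBall ε a m)
    (hy' : ∀ m < n, y ∉ chainBall ε a m) :
    |chainLength ε a x - chainLength ε a y| ≤ 2 * (dist x y / ε) := by
  have hy := mem_chainBall_succ_of_dist_lt a hx hxy
  rw [chainLength_eq_sum a hε (monotone_chainBall a hε n.le_succ hx),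
    chainLength_eq_sum a hε hy, ← Finset.sum_sub_distrib]
  have hd : 0 ≤ dist x y / ε := by positivity
  cases n with
  | zero =>
    rw [Finset.sum_range_one]
    linarith [abs_chainStep_sub_le a hε 0 x y]
  | succ n =>
    rw [Finset.sum_range_succ, Finset.sum_range_succ, Finset.sum_eq_zero, zero_add]
    · linarith [abs_add_le (chainStep ε a n x - chainStep ε a n y)
        (chainStep ε a (n + 1) x - chainStep ε a (n + 1) y),
        abs_chainStep_sub_le a hε n x y, abs_chainStep_sub_le a hε (n + 1) x y]
    · intro k hk
      have hk : k + 1 < n + 1 := Nat.succ_lt_succ (Finset.mem_range.1 hk)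
      rw [chainStep_eq_one a hε (hx' _ hk), chainStep_eq_one a hε (hy' _ hk), sub_self]

theorem abs_chainLength_sub_le (hε : 0 < ε) {x y : X} (hxy : dist x y < ε) :
    |chainLength ε a x - chainLength ε a y| ≤ 2 * (dist x y / ε) := by
  classical
  by_cases h : ∃ n, x ∈ chainBall ε a n ∨ y ∈ chainBall ε a n
  · have hmin : ∀ m < Nat.find h, x ∉ chainBall ε a m ∧ y ∉ chainBall ε a m := fun m hm =>
      not_or.1 (Nat.find_min h hm)
    rcases Nat.find_spec h with hx | hy
    · exact abs_chainLength_sub_le_of_mem a hε hxy hx (fun m hm => (hmin m hm).1)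
        fun m hm => (hmin m hm).2
    · rw [abs_sub_comm, dist_comm]
      rw [dist_comm] at hxy
      exact abs_chainLength_sub_le_of_mem a hε hxy hy (fun m hm => (hmin m hm).2)
        fun m hm => (hmin m hm).1
  -- Neither point is reachable, so both values are the default 0. A pair closer than `ε` never has
  -- exactly one reachable point, so the default creates no jump.
  · simp only [not_exists, not_or] at h
    rw [chainLength, chainLength, dif_neg (not_exists.2 fun n => (h n).1),
      dif_neg (not_exists.2 fun n => (h n).2), sub_self, abs_zero]
    positivity

theorem uniformContinuous_chainLength (hε : 0 < ε) : UniformContinuous (chainLength ε a) := by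
  refine Metric.uniformContinuous_iff.2 fun δ hδ =>
    ⟨min ε (δ * ε / 2), by positivity, fun {x y} h => ?_⟩
  rw [lt_min_iff] at h
  rw [Real.dist_eq]
  refine (abs_chainLength_sub_le a hε h.1).trans_lt ?_
  rw [← mul_div_assoc, div_lt_iff₀ hε]
  linarith [h.2]

variable (ε) in
/-- The equivalence relation generated by the pairs at distance less than `ε`. -/
def chainSetoid (X : Type u) [PseudoMetricSpace X] : Setoid X :=
  Relation.EqvGen.setoid fun x y => dist x y < ε

theorem exists_mem_chainBall_iff {x y : X} (h : chainSetoid ε X x y) :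
    (∃ n, x ∈ chainBall ε a n) ↔ ∃ n, y ∈ chainBall ε a n := by
  induction h with
  | rel x y h =>
    exact ⟨fun ⟨n, hn⟩ => ⟨n + 1, mem_chainBall_succ_of_dist_lt a hn h⟩,
      fun ⟨n, hn⟩ => ⟨n + 1, mem_chainBall_succ_of_dist_lt a hn (by rwa [dist_comm])⟩⟩
  | refl x => rfl
  | symm x y _ ih => exact ih.symm
  | trans x y z _ _ ih₁ ih₂ => exact ih₁.trans ih₂

/-- The `ε`-ball about the last point before `y` lies in a member of `C` that meets the previous
star, so one chain step costs one star. -/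
theorem chainBall_subset_iterStar {C : Set (Set X)}
    (hC : ∀ x, ∃ U ∈ C, Metric.ball x ε ⊆ U) (hε : 0 < ε) {U : Set X} (ha : a ∈ U) (k : ℕ) :
    chainBall ε a k ⊆ iterStar C U k := by
  induction k with
  | zero => exact singleton_subset_iff.2 ha
  | succ k ih =>
    intro y hy
    obtain ⟨x, hx, hyx⟩ := Metric.mem_thickening_iff.1 hy
    obtain ⟨W, hW, hxW⟩ := hC x
    exact ⟨W, ⟨hW, x, hxW (Metric.mem_ball_self hε), ih hx⟩, hxW hyx⟩

end Chain

/-! ### From uniform covers to partitions and real functions -/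

/-- For each uniform cover there is a uniform partition on each of whose members the iterated
stars are controlled by a uniformly continuous function. -/
theorem exists_isUniformPartition_of_isUniformCover {X : Type u} [u : UniformSpace X]
    {C : Set (Set X)} (hC : IsUniformCover C) :
    ∃ P : Set (Set X), IsUniformPartition P ∧ ∀ S ∈ P, ∃ U ∈ C, ∃ f : X → ℝ,
      UniformContinuous f ∧ ∀ M : ℕ, ∀ x ∈ S, f x < M → x ∈ iterStar C U M := by
  obtain ⟨V, hV, hVC⟩ := hC
  obtain ⟨I, hle, hVI⟩ := exists_coarser_pseudoMetricSpace hV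
  obtain ⟨ε, hε, hεV⟩ := Metric.mem_uniformity_dist.1 hVI
  have hball : ∀ x, ∃ U ∈ C, Metric.ball x ε ⊆ U := fun x => by
    obtain ⟨U, hU, hxU⟩ := hVC x
    exact ⟨U, hU, fun y hy => hxU (hεV (by rwa [dist_comm]))⟩
  refine ⟨(chainSetoid ε X).classes, ⟨Setoid.isPartition_classes _, ?_⟩, ?_⟩
  -- Points closer than `ε` are equivalent, so each `ε`-ball lies in one class.
  · refine ⟨{p | dist p.1 p.2 < ε}, hle (Metric.dist_mem_uniformity hε), fun x =>
      ⟨_, Setoid.mem_classes _ x, fun y hy => .symm _ _ (.rel _ _ hy)⟩⟩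
  · rintro _ ⟨a, rfl⟩
    obtain ⟨U, hU, haU⟩ := hball a
    refine ⟨U, hU, chainLength ε a,
      uniformContinuous_of_coarser (u := u) hle (uniformContinuous_chainLength a hε), fun M x hx hM => ?_⟩
    refine chainBall_subset_iterStar a hball hε (haU (Metric.mem_ball_self hε)) M
      (mem_chainBall_of_chainLength_lt a hε ?_ hM)
    exact (exists_mem_chainBall_iff a hx).2 ⟨0, mem_singleton a⟩

/-- The member of a partition that contains a given point. -/
def partitionMap {X : Type u} {P : Set (Set X)} (hP : Setoid.IsPartition P) (x : X) : P :=
  ⟨(hP.2 x).choose, (hP.2 x).choose_spec.1.1⟩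

theorem mem_partitionMap {X : Type u} {P : Set (Set X)} (hP : Setoid.IsPartition P) (x : X) :
    x ∈ (partitionMap hP x : Set X) :=
  (hP.2 x).choose_spec.1.2

theorem eq_partitionMap {X : Type u} {P : Set (Set X)} (hP : Setoid.IsPartition P) {x : X}
    {S : Set X} (hS : S ∈ P) (hx : x ∈ S) : S = partitionMap hP x :=
  (hP.2 x).choose_spec.2 S ⟨hS, hx⟩

/-- The map to a uniform partition is uniformly continuous for the discrete uniformity. -/
theorem uniformContinuous_partitionMap {X : Type u} [UniformSpace X] {P : Set (Set X)}
    (hP : IsUniformPartition P) {D : Type u} [UniformSpace D] (g : P → D) :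
    UniformContinuous fun x => g (partitionMap hP.1 x) := by
  obtain ⟨V, hV, h⟩ := hP.2
  intro W hW
  refine mem_map.2 (mem_of_superset hV ?_)
  rintro ⟨x, y⟩ hxy
  obtain ⟨S, hS, hxS⟩ := h x
  have hx : x ∈ S := hxS (refl_mem_uniformity hV)
  have hy : y ∈ S := hxS hxy
  have : partitionMap hP.1 x = partitionMap hP.1 y :=
    Subtype.ext ((eq_partitionMap hP.1 hS hx).symm.trans (eq_partitionMap hP.1 hS hy))
  change (g (partitionMap hP.1 x), g (partitionMap hP.1 y)) ∈ W
  rw [this]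
  exact refl_mem_uniformity hW

/-- A filter along which every uniform partition map is eventually constant and every uniformly
continuous real function converges is Bourbaki-Cauchy. -/
theorem isBourbakiCauchy_of_eventually {X : Type u} [UniformSpace X] {F : Filter X}
    (hpart : ∀ P : Set (Set X), IsUniformPartition P → ∃ S ∈ P, S ∈ F)
    (hreal : ∀ f : X → ℝ, UniformContinuous f → ∃ r, Tendsto f F (𝓝 r)) :
    IsBourbakiCauchy F := by
  intro C hC
  obtain ⟨P, hP, hPC⟩ := exists_isUniformPartition_of_isUniformCover hC
  obtain ⟨S, hS, hSF⟩ := hpart P hP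
  obtain ⟨U, hU, f, hf, hfS⟩ := hPC S hS
  obtain ⟨r, hr⟩ := hreal f hf
  -- Since `f` tends to `r < M`, eventually `f < M`, and `M` stars suffice on `S`.
  obtain ⟨M, hM⟩ := exists_nat_gt r
  exact ⟨M, U, hU, S ∩ f ⁻¹' Iio (M : ℝ), inter_mem hSF (hr (Iio_mem_nhds hM)),
    fun x hx => hfS M x hx.1 hx.2⟩

/-! ### The canonical map and the cardinal bound -/

/-- The index set of the discrete factors: the uniform partitions. -/
abbrev UniformPartition (X : Type u) [UniformSpace X] : Type u :=
  {P : Set (Set X) // IsUniformPartition P}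

/-- The index set of the real factors; the natural numbers only make it infinite. -/
abbrev RealIndex (X : Type u) [UniformSpace X] : Type u :=
  {f : X → ℝ // UniformContinuous f} × ℕ

/-- The first factor attached to a uniform partition is the partition itself, the others are
singletons. -/
def partitionFactor (X : Type u) [UniformSpace X] (P : UniformPartition X) : ℕ → Cardinal.{u}
  | 0 => #(P.1 : Set (Set X))
  | _ + 1 => 1

/-- A choice of a bijection of a uniform partition with its cardinal. -/
def partitionEquiv {X : Type u} [UniformSpace X] (P : UniformPartition X) :
    (P.1 : Set (Set X)) ≃ DiscreteCardinal (partitionFactor X P 0) :=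
  Cardinal.outMkEquiv.symm

/-- The coordinates of a point in the discrete factors. -/
def discreteCoord {X : Type u} [UniformSpace X] (x : X) (P : UniformPartition X) :
    (n : ℕ) → DiscreteCardinal (partitionFactor X P n)
  | 0 => partitionEquiv P (partitionMap P.2.1 x)
  | _ + 1 => (Cardinal.mk_ne_zero_iff.1 (by
      rw [Cardinal.mk_out]; exact one_ne_zero) : Nonempty (1 : Cardinal.{u}).out).some

/-- The canonical map of a uniform space into a product of discrete spaces and lines. -/
def canonicalMap (X : Type u) [UniformSpace X] (x : X) :
    (∀ p : UniformPartition X × ℕ, DiscreteCardinal (partitionFactor X p.1 p.2)) ×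
      ((#(RealIndex X)).out → ℝ) :=
  (fun p => discreteCoord x p.1 p.2, fun a => (Cardinal.outMkEquiv a).1.1 x)

theorem uniformContinuous_canonicalMap (X : Type u) [UniformSpace X] :
    UniformContinuous (canonicalMap X) := by
  refine UniformContinuous.prodMk (uniformContinuous_pi.2 ?_)
    (uniformContinuous_pi.2 fun a => (Cardinal.outMkEquiv a).1.2)
  rintro ⟨P, _ | n⟩
  · exact uniformContinuous_partitionMap P.2 (partitionEquiv P)
  · exact uniformContinuous_const

theorem canonicalMap_snd_symm {X : Type u} [UniformSpace X] {f : X → ℝ}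
    (hf : UniformContinuous f) (x : X) :
    (canonicalMap X x).2 (Cardinal.outMkEquiv.symm (⟨f, hf⟩, 0)) = f x := by
  simp [canonicalMap]

theorem isInducing_canonicalMap (X : Type u) [UniformSpace X] :
    IsInducing (canonicalMap X) := by
  refine isInducing_iff_nhds.2 fun x => le_antisymm
    (uniformContinuous_canonicalMap X).continuous.continuousAt.le_comap fun s hs => ?_
  obtain ⟨V, hV, hVs⟩ := UniformSpace.mem_nhds_iff.1 hs
  obtain ⟨f, hf, ε, hε, h⟩ := exists_uniformContinuous_ball hV x
  have hcont : Continuous fun z : (∀ p : UniformPartition X × ℕ,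
      DiscreteCardinal (partitionFactor X p.1 p.2)) × ((#(RealIndex X)).out → ℝ) =>
      z.2 (Cardinal.outMkEquiv.symm (⟨f, hf⟩, 0)) := (continuous_apply _).comp continuous_snd
  refine mem_comap.2 ⟨_, hcont.continuousAt (Metric.ball_mem_nhds _ hε), fun y hy => hVs (h y ?_)⟩
  simpa only [mem_preimage, Metric.mem_ball, Real.dist_eq, canonicalMap_snd_symm] using hy

theorem isClosed_range_canonicalMap {X : Type u} [UniformSpace X] (hX : IsBourbakiComplete X) :
    IsClosed (range (canonicalMap X)) := by
  refine isClosed_of_closure_subset fun z hz => ?_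
  let F : Filter X := comap (canonicalMap X) (𝓝 z)
  have hF : F.NeBot := by
    rw [comap_neBot_iff_frequently]
    exact mem_closure_iff_frequently.1 hz
  have hlim : Tendsto (canonicalMap X) F (𝓝 z) := tendsto_comap
  have hcauchy : IsBourbakiCauchy F := by
    refine isBourbakiCauchy_of_eventually (fun P hP => ?_) fun f hf =>
      ⟨z.2 (Cardinal.outMkEquiv.symm (⟨f, hf⟩, 0)), ?_⟩
    · have h : Tendsto (fun x => partitionEquiv ⟨P, hP⟩ (partitionMap hP.1 x)) F
          (𝓝 (z.1 (⟨P, hP⟩, 0))) :=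
        ((continuous_apply ((⟨P, hP⟩, 0) : UniformPartition X × ℕ)).comp
          continuous_fst).continuousAt.tendsto.comp hlim
      -- Convergence in a discrete factor means being eventually constant, which singles out one
      -- member of the partition.
      rw [nhds_discrete, tendsto_pure] at h
      refine ⟨_, ((partitionEquiv ⟨P, hP⟩).symm (z.1 (⟨P, hP⟩, 0))).2, ?_⟩
      filter_upwards [h] with x hx
      rw [← hx, Equiv.symm_apply_apply]
      exact mem_partitionMap hP.1 x
    · have h := ((continuous_apply (Cardinal.outMkEquiv.symm (⟨f, hf⟩, 0))).comp
        continuous_snd).continuousAt.tendsto.comp hlim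
      exact h.congr fun x => canonicalMap_snd_symm hf x
  obtain ⟨x, hx⟩ := hX F hF hcauchy
  have hclust : ClusterPt (canonicalMap X x) (𝓝 z) :=
    hx.map (uniformContinuous_canonicalMap X).continuous.continuousAt hlim
  exact ⟨x, eq_of_nhds_neBot hclust⟩

theorem partitionCardinal_le (X : Type u) [UniformSpace X] :
    partitionCardinal X ≤ ⨆ p : UniformPartition X × ℕ,
      ∏ j ∈ Finset.range (p.2 + 1), partitionFactor X p.1 j := by
  refine ciSup_le' fun P => ?_
  -- At the index `(P, 0)` the product has the single factor `#P`.
  refine le_trans (le_of_eq ?_) (le_ciSup Cardinal.bddAbove_of_small (P, 0))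
  simp [partitionFactor]

end Bourbaki

end

theorem mainTheorem6 (X : Type u) [UniformSpace X] [T2Space X]
    (hX : Bourbaki.IsBourbakiComplete X) :
    ∃ (I : Type u) (κ : I → ℕ → Cardinal.{u}) (α : Cardinal.{u})
      (φ : X → (∀ p : I × ℕ, Bourbaki.DiscreteCardinal (κ p.1 p.2)) × (α.out → ℝ)),
      ℵ₀ ≤ α ∧
      Topology.IsEmbedding φ ∧
      UniformContinuous φ ∧
      IsClosed (Set.range φ) ∧
      Bourbaki.partitionCardinal X ≤
        ⨆ p : I × ℕ, ∏ j ∈ Finset.range (p.2 + 1), κ p.1 j := by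
  -- With this, the factor `ℕ` makes `RealIndex X` infinite, so `ℵ₀ ≤ α`.
  have : Nonempty {f : X → ℝ // UniformContinuous f} := ⟨⟨0, uniformContinuous_const⟩⟩
  exact ⟨Bourbaki.UniformPartition X, Bourbaki.partitionFactor X, #(Bourbaki.RealIndex X),
    Bourbaki.canonicalMap X, Cardinal.infinite_iff.1 inferInstance,
    (Bourbaki.isInducing_canonicalMap X).isEmbedding, Bourbaki.uniformContinuous_canonicalMap X,
    Bourbaki.isClosed_range_canonicalMap hX, Bourbaki.partitionCardinal_le X⟩
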